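/- Let $(P_i)_{i\in\mathbb Z}$ be real random variables such that $\Psi=\sum_{i\in\mathbb Z}\delta_{P_i}$ is a simple, locally finite, stationary point process on $\mathbb R$. For $k\ge1$ let $\alpha^{(k)}$ be its $k$-th factorial moment measure, $\alpha^{(k)}(A)=\mathbf E\sum^{\ne}_{i_1,\dots,i_k}\mathbf 1_A(P_{i_1},\dots,P_{i_k})$, the sum being over $k$-tuples of pairwise distinct indices. Define the factorial cumulant measures on boxes with bounded Borel sides by $$\gamma^{(k)}\Big(\prod_{i=1}^k B_i\Big)=\sum_{\ell=1}^k(-1)^{\ell-1}(\ell-1)!\sum_{K_1\cup\dots\cup K_\ell=\{1,\dots,k\}}\ \prod_{j=1}^{\ell}\alpha^{(\#K_j)}\Big(\prod_{i\in K_j}B_i\Big),$$ where the inner sum is over all partitions of $\{1,\dots,k\}$ into $\ell$ non-empty sets. Suppose that $\Psi$ is Brillinger-mixing, i.e. $\lambda:=\mathbf E\Psi([0,1])>0$, $\mathbf E\Psi([0,1])^k<\infty$ for all $k\ge2$, and for every $k\ge2$ there is a signed measure $\gamma^{(k)}_{red}$ on $\mathbb R^{k-1}$ of finite total variation with $$\gamma^{(k)}\Big(\prod_{i=1}^k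 B_i\Big)=\lambda\int_{B_1}\gamma^{(k)}_{red}\Big(\prod_{i=2}^k(B_i-p)\Big)\,\mathrm dp$$ for all bounded Borel sets $B_1,\dots,B_k\subset\mathbb R$. Let $(\Phi_i,R_i)_{i\in\mathbb Z}$ be i.i.d. random vectors in $[0,\pi]\times[0,\infty)$, independent of $(P_i)_{i\in\mathbb Z}$, where $\Phi_0$ and $R_0$ are independent, $\Phi_0$ has a continuous distribution function $G$, and $\mathbf E R_0<\infty$. Put $\Xi_0=[-R_0,R_0]$ and $$\Xi=\bigcup_{i\in\mathbb Z}\big(\{(x,y)\in\mathbb R^2: x\cos\Phi_i+y\sin\Phi_i=P_i\}\oplus b(\mathbf o,R_i)\big),$$ where $b(\mathbf o,r)$ is the closed disc of radius $r$ about the origin $\mathbf o$ and $\oplus$ is the Minkowski sum. Let $K\subset\mathbb R^2$ be compact and star-shaped with respect to $\mathbf o$, with $\mathbf o$ an interior point of $K$. Then, with $|\cdot|_k$ denoting Lebesgue measure on $\mathbb R^k$, the area $|\Xi\cap\varrho K|_2$ is an integrable random variable for every real $\varrho$, and $$\frac{\mathbf E|\Xi\cap\varrho K|_2}{|\varrho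 K|_2}\xrightarrow[\varrho\to\infty]{}\sum_{k=1}^\infty\frac{(-1)^{k-1}}{k!}\,(\lambda\,\mathbf E|\Xi_0|_1)^k=1-\exp\{-\lambda\,\mathbf E|\Xi_0|_1\}.$$ -/

import Mathlib

open MeasureTheory ProbabilityTheory Filter Topology Set
open scoped Pointwise ENNReal

noncomputable section

namespace CylinderProcess

variable {Ω : Type*} [MeasurableSpace Ω]

/-- The random counting measure `Ψ = ∑_{i ∈ ℤ} δ_{P i}` on the real line. -/
def countingMeasure (P : ℤ → Ω → ℝ) (ω : Ω) : Measure ℝ :=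
  Measure.sum fun i : ℤ => Measure.dirac (P i ω)

/-- `Ψ = ∑_{i ∈ ℤ} δ_{P i}` is a simple, locally finite, stationary point process on `ℝ`.
Stationarity: the law of `Ψ`, as a random element of the space of measures with the
`σ`-algebra generated by the evaluations on Borel sets, is invariant under all translations. -/
structure IsStationaryPointProcess (μ : Measure Ω) (P : ℤ → Ω → ℝ) : Prop where
  measurable : ∀ i, Measurable (P i)
  simple : ∀ᵐ ω ∂μ, Function.Injective fun i => P i ω
  locallyFinite : ∀ᵐ ω ∂μ, ∀ B : Set ℝ, Bornology.IsBounded B → {i | P i ω ∈ B}.Finite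
  stationary : ∀ t : ℝ,
    IdentDistrib (fun ω => (countingMeasure P ω).map (fun x => x + t)) (countingMeasure P) μ μ

/-- The intensity `λ = E Ψ([0,1])`. -/
def intensity (μ : Measure Ω) (P : ℤ → Ω → ℝ) : ℝ :=
  (∫⁻ ω, countingMeasure P ω (Icc 0 1) ∂μ).toReal

/-- The factorial moment measure `α^{(k)}`, `k = #ι`, on `ℝ^ι`:
`α(A) = E ∑^{≠} 1_A(P_{i_1}, …, P_{i_k})`, the sum being over all `k`-tuples of pairwise
distinct indices. -/
def factorialMoment (μ : Measure Ω) (P : ℤ → Ω → ℝ) (ι : Type*) : Measure (ι → ℝ) :=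
  Measure.sum fun s : ι ↪ ℤ => μ.map fun ω j => P (s j) ω

/-- The value `γ^{(k)}(×_i B_i)`, `k = #ι`, of the factorial cumulant measure on the box with
sides `B i` (bounded Borel sets): the sum over all partitions `{K_1, …, K_ℓ}` of the index set of
`(-1)^{ℓ-1} (ℓ-1)! ∏_j α^{(#K_j)}(×_{i ∈ K_j} B_i)`. -/
def factorialCumulant (μ : Measure Ω) (P : ℤ → Ω → ℝ) {ι : Type*} [Fintype ι] [DecidableEq ι]
    (B : ι → Set ℝ) : ℝ :=
  ∑ π : Finpartition (Finset.univ : Finset ι),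
    (-1 : ℝ) ^ (π.parts.card - 1) * ((π.parts.card - 1).factorial : ℝ) *
      ∏ K ∈ π.parts,
        (factorialMoment μ P {i // i ∈ K} (univ.pi fun i : {i // i ∈ K} => B i.1)).toReal

/-- The signed measure `γred` on `ℝ^n` is the reduced cumulant measure of order `n + 1`:
`γ^{(n+1)}(×_i B_i) = λ ∫_{B_0} γred(×_{i ≥ 1} (B_i - p)) dp` for all bounded Borel sets `B_i`. -/
def IsReducedCumulant (μ : Measure Ω) (P : ℤ → Ω → ℝ) (n : ℕ)
    (γred : SignedMeasure (Fin n → ℝ)) : Prop :=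
  ∀ B : Fin (n + 1) → Set ℝ,
    (∀ i, MeasurableSet (B i)) → (∀ i, Bornology.IsBounded (B i)) →
      factorialCumulant μ P B =
        intensity μ P *
          ∫ p in B 0, γred (univ.pi fun j : Fin n => (fun x : ℝ => x + p) ⁻¹' B j.succ)

/-- Brillinger-mixing: a stationary point process with positive intensity, with
`E Ψ([0,1])^k < ∞` for all `k ≥ 2`, such that for each order `n + 1 ≥ 2` the reduced cumulant
measure has finite total variation. -/
structure IsBrillingerMixing (μ : Measure Ω) (P : ℤ → Ω → ℝ) : Prop
    extends IsStationaryPointProcess μ P where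
  intensity_pos : 0 < intensity μ P
  moments : ∀ k : ℕ, 2 ≤ k → ∫⁻ ω, (countingMeasure P ω (Icc 0 1)) ^ k ∂μ < ∞
  reduced : ∀ n : ℕ, 1 ≤ n → ∃ γred : SignedMeasure (Fin n → ℝ),
    IsReducedCumulant μ P n γred ∧ γred.totalVariation univ < ∞

/-- Independent marking: `(Φ_i, R_i)`, `i ∈ ℤ`, are i.i.d. mark vectors in `[0,π] × [0,∞)` with
`Φ_i ∼ G` and `R_i ∼ F` independent of each other, and the sequence of marks is independent of
the points `(P_i)`. -/
structure IsIndependentMarking (μ : Measure Ω) (P Φ R : ℤ → Ω → ℝ) (F G : Measure ℝ) : Prop where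
  measurable_angle : ∀ i, Measurable (Φ i)
  measurable_radius : ∀ i, Measurable (R i)
  angle_mem : ∀ i ω, Φ i ω ∈ Icc 0 Real.pi
  radius_nonneg : ∀ i ω, 0 ≤ R i ω
  law : ∀ i, HasLaw (fun ω => (Φ i ω, R i ω)) (G.prod F) μ
  marks_indep : iIndepFun (fun i ω => (Φ i ω, R i ω)) μ
  indep_points : IndepFun (fun ω i => P i ω) (fun ω i => (Φ i ω, R i ω)) μ

/-- The line `g(p, φ) = {(x, y) : x cos φ + y sin φ = p}`. -/
def line (p φ : ℝ) : Set (EuclideanSpace ℝ (Fin 2)) :=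
  {x | x 0 * Real.cos φ + x 1 * Real.sin φ = p}

/-- The cylinder process `Ξ = ⋃_i (g(P_i, Φ_i) ⊕ b(o, R_i))` (Minkowski sums with discs). -/
def cylinderSet (P Φ R : ℤ → Ω → ℝ) (ω : Ω) : Set (EuclideanSpace ℝ (Fin 2)) :=
  ⋃ i : ℤ, line (P i ω) (Φ i ω) + Metric.closedBall 0 (R i ω)

/-- `E |Ξ_0|_1`, the mean length of the typical base `Ξ_0 = [-R_0, R_0]`. -/
def meanBase (μ : Measure Ω) (R : ℤ → Ω → ℝ) : ℝ :=
  ∫ ω, volume.real (Icc (-(R 0 ω)) (R 0 ω)) ∂μ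

end CylinderProcess

end

noncomputable section

namespace CylinderProcess

variable {Ω : Type*} [MeasurableSpace Ω]

/-- The first moment (intensity) measure `B ↦ E Ψ(B)`. -/
def intensityMeasure (μ : Measure Ω) (P : ℤ → Ω → ℝ) : Measure ℝ :=
  Measure.sum fun i => μ.map (P i)

/-- The second factorial moment measure as a measure on `ℝ × ℝ`. -/
def pairMeasure (μ : Measure Ω) (P : ℤ → Ω → ℝ) : Measure (ℝ × ℝ) :=
  Measure.sum fun s : {q : ℤ × ℤ // q.1 ≠ q.2} => μ.map fun ω => (P s.1.1 ω, P s.1.2 ω)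

lemma countingMeasure_apply {Ω : Type*} (P : ℤ → Ω → ℝ) (ω : Ω) {B : Set ℝ} (hB : MeasurableSet B) :
    countingMeasure P ω B = ∑' i, B.indicator 1 (P i ω) := by
  simp only [countingMeasure, Measure.sum_apply _ hB, Measure.dirac_apply' _ hB]

lemma lintegral_tsum_eq_intensityMeasure {μ : Measure Ω} {P : ℤ → Ω → ℝ}
    (hP : ∀ i, Measurable (P i)) {f : ℝ → ℝ≥0∞} (hf : Measurable f) :
    ∫⁻ ω, ∑' i, f (P i ω) ∂μ = ∫⁻ x, f x ∂intensityMeasure μ P := by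
  have hm : ∀ i, Measurable fun ω => f (P i ω) := fun i => hf.comp (hP i)
  rw [lintegral_tsum fun i => (hm i).aemeasurable, intensityMeasure, lintegral_sum_measure]
  exact tsum_congr fun i => (lintegral_map hf (hP i)).symm

lemma lintegral_countingMeasure {μ : Measure Ω} {P : ℤ → Ω → ℝ}
    (hP : ∀ i, Measurable (P i)) {B : Set ℝ} (hB : MeasurableSet B) :
    ∫⁻ ω, countingMeasure P ω B ∂μ = intensityMeasure μ P B := by
  simp_rw [countingMeasure_apply P _ hB]
  rw [lintegral_tsum_eq_intensityMeasure hP (measurable_one.indicator hB), lintegral_indicator_one hB]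

lemma ENNReal.sq_tsum_eq {ι : Type*} [DecidableEq ι] (g : ι → ℝ≥0∞) :
    (∑' i, g i) ^ 2 = ∑' i, g i ^ 2 + ∑' s : {q : ι × ι // q.1 ≠ q.2}, g s.1.1 * g s.1.2 := by
  have h1 : (∑' i, g i) ^ 2 = ∑' q : ι × ι, g q.1 * g q.2 := by
    rw [ENNReal.tsum_prod', sq, ← ENNReal.tsum_mul_right]
    exact tsum_congr fun i => ENNReal.tsum_mul_left.symm
  have h2 : ∑' q : ι × ι, g q.1 * g q.2 =
      ∑' s : {q : ι × ι | q.1 = q.2}, g s.1.1 * g s.1.2 +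
        ∑' s : ({q : ι × ι | q.1 = q.2}ᶜ : Set (ι × ι)), g s.1.1 * g s.1.2 :=
    (ENNReal.summable.tsum_add_tsum_compl ENNReal.summable).symm
  rw [h1, h2]
  congr 1
  let e : ι ≃ {q : ι × ι | q.1 = q.2} :=
    { toFun := fun i => ⟨(i, i), rfl⟩
      invFun := fun q => q.1.1
      left_inv := fun i => rfl
      right_inv := fun ⟨⟨a, b⟩, h⟩ => by
        have : a = b := h
        subst this; rfl }
  rw [← e.tsum_eq]
  exact tsum_congr fun i => (sq (g i)).symm

lemma lintegral_tsum_sq {μ : Measure Ω} {P : ℤ → Ω → ℝ}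
    (hP : ∀ i, Measurable (P i)) {f : ℝ → ℝ≥0∞} (hf : Measurable f) :
    ∫⁻ ω, (∑' i, f (P i ω)) ^ 2 ∂μ =
      ∫⁻ x, f x ^ 2 ∂intensityMeasure μ P + ∫⁻ x, f x.1 * f x.2 ∂pairMeasure μ P := by
  simp_rw [ENNReal.sq_tsum_eq]
  have hm : ∀ i, Measurable fun ω => f (P i ω) := fun i => hf.comp (hP i)
  rw [lintegral_add_left (Measurable.tsum fun i => (hm i).pow_const 2),
    lintegral_tsum_eq_intensityMeasure hP (hf.pow_const 2)]
  congr 1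
  rw [lintegral_tsum
    (f := fun (s : {q : ℤ × ℤ // q.1 ≠ q.2}) ω => f (P s.1.1 ω) * f (P s.1.2 ω))
    fun s => ((hm s.1.1).mul (hm s.1.2)).aemeasurable, pairMeasure,
    lintegral_sum_measure]
  refine tsum_congr fun s => ?_
  rw [lintegral_map (by fun_prop) ((hP _).prodMk (hP _))]

lemma pairMeasure_prod_le {μ : Measure Ω} {P : ℤ → Ω → ℝ}
    (hP : ∀ i, Measurable (P i)) {B : Set ℝ} (hB : MeasurableSet B) :
    pairMeasure μ P (B ×ˢ B) ≤ ∫⁻ ω, countingMeasure P ω B ^ 2 ∂μ := by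
  simp_rw [countingMeasure_apply P _ hB]
  rw [lintegral_tsum_sq hP (measurable_one.indicator hB), ← lintegral_indicator_one (hB.prod hB)]
  refine le_trans (le_of_eq ?_) le_add_self
  refine lintegral_congr fun x => ?_
  by_cases h1 : x.1 ∈ B <;> by_cases h2 : x.2 ∈ B <;> simp [indicator, h1, h2]

lemma IsStationaryPointProcess.lintegral_comp_translate {μ : Measure Ω} {P : ℤ → Ω → ℝ}
    (hP : IsStationaryPointProcess μ P) {h : ℝ≥0∞ → ℝ≥0∞} (hh : Measurable h) (t : ℝ)
    {B : Set ℝ} (hB : MeasurableSet B) :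
    ∫⁻ ω, h (countingMeasure P ω ((fun x => x + t) ⁻¹' B)) ∂μ =
      ∫⁻ ω, h (countingMeasure P ω B) ∂μ := by
  have key := ((hP.stationary t).comp (hh.comp (Measure.measurable_coe hB))).lintegral_eq
  simpa [Function.comp_def, Measure.map_apply (measurable_add_const t) hB] using key

lemma IsStationaryPointProcess.intensityMeasure_eq {μ : Measure Ω} {P : ℤ → Ω → ℝ}
    (hP : IsStationaryPointProcess μ P) (hpos : 0 < intensity μ P) :
    intensityMeasure μ P = ENNReal.ofReal (intensity μ P) • volume := by
  have hfin : intensityMeasure μ P (Icc 0 1) ≠ ∞ := by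
    rw [← lintegral_countingMeasure hP.measurable measurableSet_Icc]
    exact (ENNReal.toReal_pos_iff.1 hpos).2.ne
  have hunit : intensityMeasure μ P (Icc 0 1) = ENNReal.ofReal (intensity μ P) := by
    rw [intensity, lintegral_countingMeasure hP.measurable measurableSet_Icc,
      ENNReal.ofReal_toReal hfin]
  have : (intensityMeasure μ P).IsAddLeftInvariant := ⟨fun t => by
    ext B hB
    rw [Measure.map_apply (measurable_const_add t) hB,
      ← lintegral_countingMeasure hP.measurable (measurable_const_add t hB),
      ← lintegral_countingMeasure hP.measurable hB]
    simpa [add_comm] using hP.lintegral_comp_translate measurable_id t hB⟩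
  have : IsFiniteMeasureOnCompacts (intensityMeasure μ P) := ⟨fun k hk =>
    measure_lt_top_of_isCompact_of_isAddLeftInvariant (Ioo 0 1) isOpen_Ioo (by simp)
      (ne_top_of_le_ne_top hfin (measure_mono Ioo_subset_Icc_self)) hk⟩
  have h := Measure.isAddLeftInvariant_eq_smul (intensityMeasure μ P) volume
  generalize Measure.addHaarScalarFactor (intensityMeasure μ P) volume = c at h
  rw [h] at hunit ⊢
  simp only [Measure.smul_apply, Real.volume_Icc, sub_zero, ENNReal.ofReal_one] at hunit
  rw [← hunit, show c • (1 : ℝ≥0∞) = c by rw [ENNReal.smul_def, smul_eq_mul, mul_one]]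
  rfl

lemma IsBrillingerMixing.lintegral_countingMeasure_sq_Icc {μ : Measure Ω} {P : ℤ → Ω → ℝ}
    (hP : IsBrillingerMixing μ P) (n : ℕ) :
    ∫⁻ ω, countingMeasure P ω (Icc 0 n) ^ 2 ∂μ < ∞ := by
  induction n with
  | zero =>
    refine lt_of_le_of_lt (lintegral_mono fun ω => ?_) (hP.moments 2 le_rfl)
    gcongr
    simp
  | succ n ih =>
    have hstep : ∫⁻ ω, countingMeasure P ω (Icc (n : ℝ) (n + 1)) ^ 2 ∂μ < ∞ := by
      have := hP.lintegral_comp_translate (h := fun x => x ^ 2) (by fun_prop) (-(n : ℝ))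
        (measurableSet_Icc (a := 0) (b := 1))
      have hpre : (fun x : ℝ => x + -(n : ℝ)) ⁻¹' Icc 0 1 = Icc (n : ℝ) (n + 1) := by
        ext x; simp only [mem_preimage, mem_Icc]; constructor <;> rintro ⟨h1, h2⟩ <;>
          constructor <;> linarith
      rw [hpre] at this
      rw [this]
      exact hP.moments 2 le_rfl
    have hmeas : ∀ B : Set ℝ, MeasurableSet B → Measurable fun ω => countingMeasure P ω B := by
      intro B hB
      simp_rw [countingMeasure_apply P _ hB]
      exact Measurable.tsum fun i => (measurable_one.indicator hB).comp (hP.measurable i)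
    calc ∫⁻ ω, countingMeasure P ω (Icc 0 ((n + 1 : ℕ) : ℝ)) ^ 2 ∂μ
        ≤ ∫⁻ ω, (2 * countingMeasure P ω (Icc 0 n) ^ 2 +
            2 * countingMeasure P ω (Icc (n : ℝ) (n + 1)) ^ 2) ∂μ := by
          refine lintegral_mono fun ω => ?_
          have hsub : Icc (0 : ℝ) ((n + 1 : ℕ) : ℝ) ⊆ Icc 0 (n : ℝ) ∪ Icc (n : ℝ) (n + 1) := by
            push_cast
            exact Icc_subset_Icc_union_Icc
          have h1 := (measure_mono hsub).trans
            (measure_union_le (μ := countingMeasure P ω) (Icc 0 (n : ℝ)) (Icc (n : ℝ) (n + 1)))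
          refine (pow_le_pow_left' h1 2).trans ?_
          have h3 := ENNReal.rpow_add_le_mul_rpow_add_rpow (countingMeasure P ω (Icc 0 (n : ℝ)))
            (countingMeasure P ω (Icc (n : ℝ) (n + 1))) (p := 2) (by norm_num)
          norm_num at h3
          rwa [mul_add] at h3
      _ < ∞ := by
          rw [lintegral_add_left (by have := hmeas (Icc 0 n) measurableSet_Icc; fun_prop),
            lintegral_const_mul _ ((hmeas _ measurableSet_Icc).pow_const 2),
            lintegral_const_mul _ ((hmeas _ measurableSet_Icc).pow_const 2)]
          exact ENNReal.add_lt_top.2 ⟨ENNReal.mul_lt_top (by simp) ih,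
            ENNReal.mul_lt_top (by simp) hstep⟩

lemma IsBrillingerMixing.pairMeasure_prod_lt_top {μ : Measure Ω} {P : ℤ → Ω → ℝ}
    (hP : IsBrillingerMixing μ P) {A B : Set ℝ} (hA : Bornology.IsBounded A)
    (hB : Bornology.IsBounded B) : pairMeasure μ P (A ×ˢ B) < ∞ := by
  obtain ⟨r, hr⟩ := (hA.union hB).subset_closedBall 0
  obtain ⟨N, hN⟩ := exists_nat_ge r
  have hsub : A ∪ B ⊆ Icc (-(N : ℝ)) N := by
    refine hr.trans ?_
    rw [Real.closedBall_eq_Icc]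
    exact Icc_subset_Icc (by linarith) (by linarith)
  have hsq : ∫⁻ ω, countingMeasure P ω (Icc (-(N : ℝ)) N) ^ 2 ∂μ < ∞ := by
    have := hP.lintegral_comp_translate (h := fun x => x ^ 2) (by fun_prop) (N : ℝ)
      (measurableSet_Icc (a := 0) (b := ((2 * N : ℕ) : ℝ)))
    have hpre : (fun x : ℝ => x + (N : ℝ)) ⁻¹' Icc 0 ((2 * N : ℕ) : ℝ) = Icc (-(N : ℝ)) N := by
      push_cast
      ext x; simp only [mem_preimage, mem_Icc]; constructor <;> rintro ⟨h1, h2⟩ <;>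
        constructor <;> linarith
    rw [hpre] at this
    rw [this]
    exact hP.lintegral_countingMeasure_sq_Icc _
  exact (measure_mono (prod_mono (subset_union_left.trans hsub)
    (subset_union_right.trans hsub))).trans_lt
    ((pairMeasure_prod_le hP.measurable measurableSet_Icc).trans_lt hsq)

lemma factorialMoment_pi_of_unique {ι : Type*} [Countable ι] {μ : Measure Ω} {P : ℤ → Ω → ℝ}
    (hP : ∀ i, Measurable (P i)) (a : ι) (ha : ∀ j, j = a) {B : ι → Set ℝ}
    (hB : ∀ i, MeasurableSet (B i)) :
    factorialMoment μ P ι (univ.pi B) = intensityMeasure μ P (B a) := by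
  have : Subsingleton ι := ⟨fun i j => (ha i).trans (ha j).symm⟩
  let e : (ι ↪ ℤ) ≃ ℤ :=
    { toFun := fun s => s a
      invFun := fun n => ⟨fun _ => n, Function.injective_of_subsingleton _⟩
      left_inv := fun s => by ext j; simp [ha j]
      right_inv := fun n => rfl }
  rw [factorialMoment, intensityMeasure, Measure.sum_apply _ (MeasurableSet.univ_pi hB),
    Measure.sum_apply _ (hB a), ← e.tsum_eq]
  refine tsum_congr fun s => ?_
  rw [Measure.map_apply (measurable_pi_lambda _ fun j => hP (s j)) (MeasurableSet.univ_pi hB),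
    Measure.map_apply (hP _) (hB a)]
  congr 1
  ext ω
  simp only [mem_preimage, mem_univ_pi]
  refine ⟨fun h => h a, fun h j => ?_⟩
  rw [ha j]
  exact h

lemma factorialMoment_pi_of_pair {ι : Type*} [Countable ι] {μ : Measure Ω} {P : ℤ → Ω → ℝ}
    (hP : ∀ i, Measurable (P i)) (a b : ι) (hne : a ≠ b) (hab : ∀ j, j = a ∨ j = b)
    {B : ι → Set ℝ} (hB : ∀ i, MeasurableSet (B i)) :
    factorialMoment μ P ι (univ.pi B) = pairMeasure μ P (B a ×ˢ B b) := by
  let φ : (ι ↪ ℤ) → {q : ℤ × ℤ // q.1 ≠ q.2} := fun s => ⟨(s a, s b), fun h => hne (s.injective h)⟩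
  have hφ : Function.Bijective φ := by
    classical
    constructor
    · intro s t hst
      have h := congrArg Subtype.val hst
      ext j
      rcases hab j with rfl | rfl
      · exact congrArg Prod.fst h
      · exact congrArg Prod.snd h
    · rintro ⟨⟨m, n⟩, hmn⟩
      replace hmn : m ≠ n := hmn
      refine ⟨⟨fun j => if j = a then m else n, fun i j hij => ?_⟩, ?_⟩
      · rcases hab i with rfl | rfl <;> rcases hab j with rfl | rfl <;>
          simp_all [hne.symm, hmn.symm]
      · exact Subtype.ext (Prod.ext (if_pos rfl) (if_neg hne.symm))
  rw [factorialMoment, pairMeasure, Measure.sum_apply _ (MeasurableSet.univ_pi hB),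
    Measure.sum_apply _ ((hB a).prod (hB b)), ← (Equiv.ofBijective φ hφ).tsum_eq]
  refine tsum_congr fun s => ?_
  rw [Measure.map_apply (measurable_pi_lambda _ fun j => hP (s j)) (MeasurableSet.univ_pi hB),
    Measure.map_apply ((hP _).prodMk (hP _)) ((hB a).prod (hB b))]
  congr 1
  ext ω
  simp only [mem_preimage, mem_univ_pi, mem_prod, Equiv.ofBijective_apply, φ]
  refine ⟨fun h => ⟨h a, h b⟩, fun h j => ?_⟩
  rcases hab j with rfl | rfl
  · exact h.1
  · exact h.2

lemma univ_finpartition_fin_two :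
    (Finset.univ : Finset (Finpartition (Finset.univ : Finset (Fin 2)))) =
      {⊥, Finpartition.indiscrete (by decide)} := by
  decide

lemma factorialCumulant_fin_two {μ : Measure Ω} {P : ℤ → Ω → ℝ}
    (hP : ∀ i, Measurable (P i)) {B : Fin 2 → Set ℝ} (hB : ∀ i, MeasurableSet (B i)) :
    factorialCumulant μ P B = (pairMeasure μ P (B 0 ×ˢ B 1)).toReal -
      (intensityMeasure μ P (B 0)).toReal * (intensityMeasure μ P (B 1)).toReal := by
  have hsingle : ∀ a : Fin 2, factorialMoment μ P {i // i ∈ ({a} : Finset (Fin 2))}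
      (univ.pi fun i : {i // i ∈ ({a} : Finset (Fin 2))} => B i.1) =
      intensityMeasure μ P (B a) := fun a =>
    factorialMoment_pi_of_unique hP ⟨a, Finset.mem_singleton_self a⟩
      (fun j => Subtype.ext (Finset.mem_singleton.1 j.2)) fun i => hB i.1
  have hpair : factorialMoment μ P {i // i ∈ (Finset.univ : Finset (Fin 2))}
      (univ.pi fun i : {i // i ∈ (Finset.univ : Finset (Fin 2))} => B i.1) =
      pairMeasure μ P (B 0 ×ˢ B 1) :=
    factorialMoment_pi_of_pair (ι := {i // i ∈ (Finset.univ : Finset (Fin 2))})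
      (B := fun i => B i.1) hP ⟨0, Finset.mem_univ _⟩ ⟨1, Finset.mem_univ _⟩ (by simp)
      (fun ⟨j, _⟩ => by
        rcases Fin.exists_fin_two.1 ⟨j, rfl⟩ with h | h
        · exact Or.inl (Subtype.ext h)
        · exact Or.inr (Subtype.ext h)) fun i => hB i.1
  rw [factorialCumulant, univ_finpartition_fin_two, Finset.sum_pair (by decide)]
  have h1 : (⊥ : Finpartition (Finset.univ : Finset (Fin 2))).parts = {{0}, {1}} := by decide
  rw [h1, Finpartition.indiscrete_parts, Finset.prod_pair (by decide), Finset.prod_singleton,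
    hsingle, hsingle, hpair, Finset.card_pair (by decide), Finset.card_singleton]
  simp only [Nat.reduceSub, pow_one, pow_zero, Nat.factorial]
  push_cast
  ring

/-- The image of `dp ⊗ ν(dq)` under `(p, q) ↦ (p, p + q)`. -/
def shiftMeasure (ν : Measure (Fin 1 → ℝ)) : Measure (ℝ × ℝ) :=
  ((volume : Measure ℝ).prod ν).map fun x => (x.1, x.2 0 + x.1)

lemma measurable_shift : Measurable fun x : ℝ × (Fin 1 → ℝ) => (x.1, x.2 0 + x.1) := by
  fun_prop

lemma measurableSet_pi_shift {B : Set ℝ} (hB : MeasurableSet B) (p : ℝ) :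
    MeasurableSet (univ.pi fun _ : Fin 1 => (fun x : ℝ => x + p) ⁻¹' B) :=
  MeasurableSet.univ_pi fun _ => measurable_add_const p hB

lemma measurable_measure_pi_shift (ν : Measure (Fin 1 → ℝ)) [IsFiniteMeasure ν] {B : Set ℝ}
    (hB : MeasurableSet B) :
    Measurable fun p : ℝ => ν (univ.pi fun _ : Fin 1 => (fun x : ℝ => x + p) ⁻¹' B) := by
  have h : MeasurableSet {x : ℝ × (Fin 1 → ℝ) | x.2 0 + x.1 ∈ B} :=
    (by fun_prop : Measurable fun x : ℝ × (Fin 1 → ℝ) => x.2 0 + x.1) hB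
  convert measurable_measure_prodMk_left (ν := ν) h using 3 with p
  ext q
  simp

lemma shiftMeasure_prod (ν : Measure (Fin 1 → ℝ)) [IsFiniteMeasure ν] {A B : Set ℝ}
    (hA : MeasurableSet A) (hB : MeasurableSet B) :
    shiftMeasure ν (A ×ˢ B) =
      ∫⁻ p in A, ν (univ.pi fun _ : Fin 1 => (fun x : ℝ => x + p) ⁻¹' B) := by
  rw [shiftMeasure, Measure.map_apply measurable_shift (hA.prod hB),
    Measure.prod_apply (measurable_shift (hA.prod hB)), ← lintegral_indicator hA]
  refine lintegral_congr fun p => ?_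
  by_cases hp : p ∈ A
  · rw [indicator_of_mem hp]
    congr 1
    ext q
    simp [hp]
  · rw [indicator_of_notMem hp]
    convert measure_empty (μ := ν)
    ext q
    simp [hp]

lemma shiftMeasure_prod_lt_top (ν : Measure (Fin 1 → ℝ)) [IsFiniteMeasure ν] {A B : Set ℝ}
    (hA : MeasurableSet A) (hB : MeasurableSet B) (hbA : Bornology.IsBounded A) :
    shiftMeasure ν (A ×ˢ B) < ∞ := by
  rw [shiftMeasure_prod ν hA hB]
  refine (lintegral_mono fun p => measure_mono (subset_univ _)).trans_lt ?_
  rw [lintegral_const, Measure.restrict_apply_univ]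
  exact ENNReal.mul_lt_top (measure_lt_top _ _) hbA.measure_lt_top

lemma setIntegral_toReal_pi_shift (ν : Measure (Fin 1 → ℝ)) [IsFiniteMeasure ν] {A B : Set ℝ}
    (hA : MeasurableSet A) (hB : MeasurableSet B) (hbA : Bornology.IsBounded A) :
    IntegrableOn
        (fun p => ν.real (univ.pi fun _ : Fin 1 => (fun x : ℝ => x + p) ⁻¹' B)) A ∧
      ∫ p in A, ν.real (univ.pi fun _ : Fin 1 => (fun x : ℝ => x + p) ⁻¹' B) =
        (shiftMeasure ν (A ×ˢ B)).toReal := by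
  have hm := (measurable_measure_pi_shift ν hB).aemeasurable (μ := volume.restrict A)
  have hfin := shiftMeasure_prod_lt_top ν hA hB hbA
  rw [shiftMeasure_prod ν hA hB] at hfin ⊢
  exact ⟨integrable_toReal_of_lintegral_ne_top hm hfin.ne,
    integral_toReal hm (.of_forall fun _ => measure_lt_top _ _)⟩

lemma IsBrillingerMixing.pairMeasure_prod_add {μ : Measure Ω} {P : ℤ → Ω → ℝ}
    (hP : IsBrillingerMixing μ P) {γ : SignedMeasure (Fin 1 → ℝ)}
    (hγ : IsReducedCumulant μ P 1 γ) {A B : Set ℝ}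
    (hA : MeasurableSet A) (hB : MeasurableSet B) (hbA : Bornology.IsBounded A)
    (hbB : Bornology.IsBounded B) :
    pairMeasure μ P (A ×ˢ B) +
        ENNReal.ofReal (intensity μ P) * shiftMeasure γ.toJordanDecomposition.negPart (A ×ˢ B) =
      intensityMeasure μ P A * intensityMeasure μ P B +
        ENNReal.ofReal (intensity μ P) *
          shiftMeasure γ.toJordanDecomposition.posPart (A ×ˢ B) := by
  have hpos := hP.intensity_pos
  have hα := hP.intensityMeasure_eq hpos
  have hint : ∀ {C : Set ℝ}, Bornology.IsBounded C → intensityMeasure μ P C ≠ ∞ := by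
    intro C hC
    rw [hα, Measure.smul_apply, smul_eq_mul]
    exact ENNReal.mul_ne_top ENNReal.ofReal_ne_top hC.measure_lt_top.ne
  have h := hγ ![A, B] (by intro i; fin_cases i <;> assumption)
    (by intro i; fin_cases i <;> assumption)
  rw [factorialCumulant_fin_two hP.measurable (by intro i; fin_cases i <;> assumption)] at h
  obtain ⟨hi₁, he₁⟩ := setIntegral_toReal_pi_shift γ.toJordanDecomposition.posPart hA hB hbA
  obtain ⟨hi₂, he₂⟩ := setIntegral_toReal_pi_shift γ.toJordanDecomposition.negPart hA hB hbA
  have hval : ∀ p : ℝ, γ (univ.pi fun _ : Fin 1 => (fun x : ℝ => x + p) ⁻¹' B) =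
      γ.toJordanDecomposition.posPart.real (univ.pi fun _ : Fin 1 => (fun x : ℝ => x + p) ⁻¹' B) -
      γ.toJordanDecomposition.negPart.real
        (univ.pi fun _ : Fin 1 => (fun x : ℝ => x + p) ⁻¹' B) := by
    intro p
    have hs := measurableSet_pi_shift hB p
    conv_lhs => rw [← γ.toSignedMeasure_toJordanDecomposition]
    rw [JordanDecomposition.toSignedMeasure, sub_apply,
      Measure.toSignedMeasure_apply_measurable hs, Measure.toSignedMeasure_apply_measurable hs]
  have hI : ∫ p in A, γ (univ.pi fun _ : Fin 1 => (fun x : ℝ => x + p) ⁻¹' B) =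
      (shiftMeasure γ.toJordanDecomposition.posPart (A ×ˢ B)).toReal -
        (shiftMeasure γ.toJordanDecomposition.negPart (A ×ˢ B)).toReal := by
    simp_rw [hval]
    rw [integral_sub hi₁ hi₂, he₁, he₂]
  have h' : (pairMeasure μ P (A ×ˢ B)).toReal -
      (intensityMeasure μ P A).toReal * (intensityMeasure μ P B).toReal =
      intensity μ P * ((shiftMeasure γ.toJordanDecomposition.posPart (A ×ˢ B)).toReal -
        (shiftMeasure γ.toJordanDecomposition.negPart (A ×ˢ B)).toReal) := by
    rw [← hI]
    simpa using h
  have hf₁ := (hP.pairMeasure_prod_lt_top hbA hbB).ne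
  have hf₂ := ENNReal.mul_ne_top (ENNReal.ofReal_ne_top (r := intensity μ P))
    (shiftMeasure_prod_lt_top γ.toJordanDecomposition.posPart hA hB hbA).ne
  have hf₃ := ENNReal.mul_ne_top (ENNReal.ofReal_ne_top (r := intensity μ P))
    (shiftMeasure_prod_lt_top γ.toJordanDecomposition.negPart hA hB hbA).ne
  have hf₄ := ENNReal.mul_ne_top (hint hbA) (hint hbB)
  rw [← ENNReal.toReal_eq_toReal_iff' (ENNReal.add_ne_top.2 ⟨hf₁, hf₃⟩)
    (ENNReal.add_ne_top.2 ⟨hf₄, hf₂⟩), ENNReal.toReal_add hf₁ hf₃, ENNReal.toReal_add hf₄ hf₂]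
  simp only [ENNReal.toReal_mul, ENNReal.toReal_ofReal hpos.le]
  linarith

lemma IsBrillingerMixing.pairMeasure_add {μ : Measure Ω} {P : ℤ → Ω → ℝ}
    (hP : IsBrillingerMixing μ P) {γ : SignedMeasure (Fin 1 → ℝ)}
    (hγ : IsReducedCumulant μ P 1 γ) :
    pairMeasure μ P +
        ENNReal.ofReal (intensity μ P) • shiftMeasure γ.toJordanDecomposition.negPart =
      ENNReal.ofReal (intensity μ P) ^ 2 • (volume : Measure ℝ).prod volume +
        ENNReal.ofReal (intensity μ P) • shiftMeasure γ.toJordanDecomposition.posPart := by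
  have hbox : ∀ {A B : Set ℝ}, MeasurableSet A → MeasurableSet B → Bornology.IsBounded A →
      Bornology.IsBounded B →
      (pairMeasure μ P +
        ENNReal.ofReal (intensity μ P) • shiftMeasure γ.toJordanDecomposition.negPart) (A ×ˢ B) =
      (ENNReal.ofReal (intensity μ P) ^ 2 • (volume : Measure ℝ).prod (volume : Measure ℝ) +
        ENNReal.ofReal (intensity μ P) •
          shiftMeasure γ.toJordanDecomposition.posPart : Measure (ℝ × ℝ)) (A ×ˢ B) := by
    intro A B hA hB hbA hbB
    have h := hP.pairMeasure_prod_add hγ hA hB hbA hbB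
    rw [hP.intensityMeasure_eq hP.intensity_pos] at h
    simp only [Measure.add_apply, Measure.smul_apply, smul_eq_mul, Measure.prod_prod] at h ⊢
    rw [h]
    ring
  refine Measure.ext_of_iUnion_eq_univ
    (s := fun n : ℕ => Icc (-(n : ℝ)) n ×ˢ Icc (-(n : ℝ)) n) ?_ fun n => ?_
  · refine eq_univ_of_forall fun x => ?_
    obtain ⟨n, hn⟩ := exists_nat_ge (max |x.1| |x.2|)
    exact mem_iUnion.2 ⟨n, abs_le.1 ((le_max_left _ _).trans hn),
      abs_le.1 ((le_max_right _ _).trans hn)⟩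
  · have hI : Bornology.IsBounded (Icc (-(n : ℝ)) n) := Metric.isBounded_Icc _ _
    have hfin : IsFiniteMeasure ((pairMeasure μ P + ENNReal.ofReal (intensity μ P) •
        shiftMeasure γ.toJordanDecomposition.negPart).restrict
          (Icc (-(n : ℝ)) n ×ˢ Icc (-(n : ℝ)) n)) := by
      refine ⟨?_⟩
      rw [Measure.restrict_apply_univ, Measure.add_apply, Measure.smul_apply, smul_eq_mul]
      exact ENNReal.add_lt_top.2 ⟨hP.pairMeasure_prod_lt_top hI hI,
        ENNReal.mul_lt_top ENNReal.ofReal_lt_top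
          (shiftMeasure_prod_lt_top _ measurableSet_Icc measurableSet_Icc hI)⟩
    refine Measure.ext_prod fun {A B} hA hB => ?_
    rw [Measure.restrict_apply (hA.prod hB), Measure.restrict_apply (hA.prod hB), prod_inter_prod]
    exact hbox (hA.inter measurableSet_Icc) (hB.inter measurableSet_Icc)
      (hI.subset inter_subset_right) (hI.subset inter_subset_right)

lemma lintegral_shiftMeasure_le (ν : Measure (Fin 1 → ℝ)) [IsFiniteMeasure ν] {f : ℝ → ℝ≥0∞}
    (hf : Measurable f) {ε : ℝ≥0∞} (hε : ∀ x, f x ≤ ε) :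
    ∫⁻ x, f x.1 * f x.2 ∂shiftMeasure ν ≤ ν univ * ε * ∫⁻ x, f x := by
  rw [shiftMeasure, lintegral_map (by fun_prop) measurable_shift]
  calc ∫⁻ x : ℝ × (Fin 1 → ℝ), f x.1 * f (x.2 0 + x.1) ∂(volume.prod ν)
      ≤ ∫⁻ x : ℝ × (Fin 1 → ℝ), f x.1 * ε ∂(volume.prod ν) :=
        lintegral_mono fun x => mul_le_mul_right (hε _) _
    _ = ν univ * ε * ∫⁻ x, f x := by
        rw [lintegral_mul_const _ (by fun_prop),
          lintegral_prod _ (by fun_prop : Measurable fun x : ℝ × (Fin 1 → ℝ) => f x.1).aemeasurable]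
        simp only [lintegral_const]
        rw [lintegral_mul_const _ hf]
        ring

lemma IsBrillingerMixing.exists_lintegral_tsum_sq_le {μ : Measure Ω} {P : ℤ → Ω → ℝ}
    (hP : IsBrillingerMixing μ P) :
    ∃ C : ℝ≥0∞, C ≠ ∞ ∧ ∀ (f : ℝ → ℝ≥0∞) (ε : ℝ≥0∞), Measurable f → (∀ x, f x ≤ ε) →
      ∫⁻ ω, (∑' i, f (P i ω)) ^ 2 ∂μ ≤
        (ENNReal.ofReal (intensity μ P) * ∫⁻ x, f x) ^ 2 + C * ε * ∫⁻ x, f x := by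
  obtain ⟨γ, hγ, -⟩ := hP.reduced 1 le_rfl
  set l := ENNReal.ofReal (intensity μ P) with hl
  refine ⟨l * (1 + γ.toJordanDecomposition.posPart univ), ENNReal.mul_ne_top
    ENNReal.ofReal_ne_top (ENNReal.add_ne_top.2 ⟨ENNReal.one_ne_top, measure_ne_top _ _⟩), ?_⟩
  intro f ε hf hε
  rw [lintegral_tsum_sq hP.measurable hf, hP.intensityMeasure_eq hP.intensity_pos, ← hl]
  have hdiag : ∫⁻ x, f x ^ 2 ∂(l • (volume : Measure ℝ)) ≤ l * (ε * ∫⁻ x, f x) := by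
    rw [lintegral_smul_measure, smul_eq_mul, ← lintegral_const_mul _ hf]
    gcongr with x
    rw [sq]
    gcongr
    exact hε x
  have hoff : ∫⁻ x, f x.1 * f x.2 ∂pairMeasure μ P ≤ l ^ 2 * (∫⁻ x, f x) ^ 2 +
      l * (γ.toJordanDecomposition.posPart univ * ε * ∫⁻ x, f x) := by
    calc ∫⁻ x, f x.1 * f x.2 ∂pairMeasure μ P
        ≤ ∫⁻ x, f x.1 * f x.2 ∂(pairMeasure μ P +
            l • shiftMeasure γ.toJordanDecomposition.negPart) := by
          rw [lintegral_add_measure]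
          exact le_self_add
      _ = l ^ 2 * (∫⁻ x, f x) ^ 2 +
            l * ∫⁻ x, f x.1 * f x.2 ∂shiftMeasure γ.toJordanDecomposition.posPart := by
          rw [hP.pairMeasure_add hγ, lintegral_add_measure, lintegral_smul_measure,
            lintegral_smul_measure, smul_eq_mul, smul_eq_mul,
            lintegral_prod_mul hf.aemeasurable hf.aemeasurable, sq (∫⁻ x, f x)]
      _ ≤ _ := by
          gcongr
          exact lintegral_shiftMeasure_le _ hf hε
  calc _ ≤ l * (ε * ∫⁻ x, f x) + (l ^ 2 * (∫⁻ x, f x) ^ 2 +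
      l * (γ.toJordanDecomposition.posPart univ * ε * ∫⁻ x, f x)) := add_le_add hdiag hoff
    _ = _ := by ring

lemma integral_abs_sub_le_sqrt {μ : Measure Ω} [IsProbabilityMeasure μ] {S : Ω → ℝ}
    (hS : MemLp S 2 μ) {D : ℝ} (hD : ∫ ω, S ω ^ 2 ∂μ ≤ (∫ ω, S ω ∂μ) ^ 2 + D) :
    ∫ ω, |S ω - ∫ ω', S ω' ∂μ| ∂μ ≤ √D := by
  set m := ∫ ω', S ω' ∂μ with hm
  have hX : MemLp (fun ω => S ω - m) 2 μ := hS.sub (memLp_const m)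
  have hvar : ∫ ω, (S ω - m) ^ 2 ∂μ ≤ D := by
    have h1 := variance_eq_sub hS
    rw [variance_eq_integral hS.aemeasurable] at h1
    simp only [Pi.pow_apply, ← hm] at h1
    linarith
  have h2 := variance_nonneg (fun ω => ‖S ω - m‖) μ
  rw [variance_eq_sub hX.norm] at h2
  refine Real.le_sqrt_of_sq_le ?_
  simp only [Pi.pow_apply, Real.norm_eq_abs, sq_abs] at h2
  linarith

/-- In `L¹`, the sums `∑ f(P_i)` are close to their mean when `f` is uniformly small. -/
lemma IsBrillingerMixing.exists_integral_abs_sub_le {μ : Measure Ω} [IsProbabilityMeasure μ]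
    {P : ℤ → Ω → ℝ} (hP : IsBrillingerMixing μ P) :
    ∃ C : ℝ, ∀ (f : ℝ → ℝ≥0∞) (ε a : ℝ), 0 ≤ ε → 0 ≤ a → Measurable f →
      (∀ x, f x ≤ ENNReal.ofReal ε) → ∫⁻ x, f x = ENNReal.ofReal a →
      (∀ᵐ ω ∂μ, ∑' i, f (P i ω) < ∞) ∧ Integrable (fun ω => (∑' i, f (P i ω)).toReal) μ ∧
        ∫ ω, |(∑' i, f (P i ω)).toReal - intensity μ P * a| ∂μ ≤ √(C * ε * a) := by
  obtain ⟨C, hC, hbound⟩ := hP.exists_lintegral_tsum_sq_le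
  refine ⟨C.toReal, fun f ε a hε0 ha0 hf hε ha => ?_⟩
  have hpos := hP.intensity_pos
  have hTm : Measurable fun ω => ∑' i, f (P i ω) :=
    Measurable.tsum fun i => hf.comp (hP.measurable i)
  have hmean : ∫⁻ ω, ∑' i, f (P i ω) ∂μ = ENNReal.ofReal (intensity μ P * a) := by
    rw [lintegral_tsum_eq_intensityMeasure hP.measurable hf, hP.intensityMeasure_eq hpos,
      lintegral_smul_measure, ha, smul_eq_mul, ENNReal.ofReal_mul hpos.le]
  have hsq := hbound f _ hf hε
  rw [ha, ← ENNReal.ofReal_mul hpos.le] at hsq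
  have hsqfin : ENNReal.ofReal (intensity μ P * a) ^ 2 + C * ENNReal.ofReal ε * ENNReal.ofReal a
      ≠ ∞ := ENNReal.add_ne_top.2 ⟨ENNReal.pow_ne_top ENNReal.ofReal_ne_top,
        ENNReal.mul_ne_top (ENNReal.mul_ne_top hC ENNReal.ofReal_ne_top) ENNReal.ofReal_ne_top⟩
  have hfin : ∀ᵐ ω ∂μ, ∑' i, f (P i ω) < ∞ :=
    ae_lt_top hTm (hmean ▸ ENNReal.ofReal_ne_top)
  have hSint : Integrable (fun ω => (∑' i, f (P i ω)).toReal) μ :=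
    integrable_toReal_of_lintegral_ne_top hTm.aemeasurable (hmean ▸ ENNReal.ofReal_ne_top)
  have hSmean : ∫ ω, (∑' i, f (P i ω)).toReal ∂μ = intensity μ P * a := by
    rw [integral_toReal hTm.aemeasurable hfin, hmean,
      ENNReal.toReal_ofReal (mul_nonneg hpos.le ha0)]
  have hS2 : MemLp (fun ω => (∑' i, f (P i ω)).toReal) 2 μ := by
    rw [memLp_two_iff_integrable_sq hSint.aestronglyMeasurable]
    simp_rw [← ENNReal.toReal_pow]
    exact integrable_toReal_of_lintegral_ne_top (hTm.pow_const 2).aemeasurable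
      (ne_top_of_le_ne_top hsqfin hsq)
  refine ⟨hfin, hSint, ?_⟩
  rw [← hSmean]
  refine integral_abs_sub_le_sqrt hS2 ?_
  rw [hSmean]
  simp_rw [← ENNReal.toReal_pow]
  rw [integral_toReal (hTm.pow_const 2).aemeasurable
    (hfin.mono fun ω hω => ENNReal.pow_lt_top hω)]
  refine (ENNReal.toReal_mono hsqfin hsq).trans (le_of_eq ?_)
  rw [ENNReal.toReal_add (ENNReal.pow_ne_top ENNReal.ofReal_ne_top)
    (ENNReal.mul_ne_top (ENNReal.mul_ne_top hC ENNReal.ofReal_ne_top) ENNReal.ofReal_ne_top),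
    ENNReal.toReal_pow, ENNReal.toReal_mul, ENNReal.toReal_mul,
    ENNReal.toReal_ofReal (mul_nonneg hpos.le ha0), ENNReal.toReal_ofReal hε0,
    ENNReal.toReal_ofReal ha0]

lemma exp_neg_le_exp_neg_add_abs {a b : ℝ} (ha : 0 ≤ a) :
    Real.exp (-a) ≤ Real.exp (-b) + |a - b| := by
  rcases le_total b a with h | h
  · exact (Real.exp_le_exp.2 (neg_le_neg h)).trans (le_add_of_nonneg_right (abs_nonneg _))
  · rw [abs_of_nonpos (sub_nonpos.2 h)]
    have h1 : Real.exp (-b) = Real.exp (-a) * Real.exp (-(b - a)) := by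
      rw [← Real.exp_add]; congr 1; ring
    have h2 := Real.one_sub_le_exp_neg (b - a)
    have h3 : Real.exp (-a) ≤ 1 := Real.exp_le_one_iff.2 (by linarith)
    have h4 := Real.exp_pos (-a)
    rw [h1]
    nlinarith

lemma exp_neg_div_le_one_sub {q ε : ℝ} (hq : 0 ≤ q) (hqε : q ≤ ε) (hε : ε < 1) :
    Real.exp (-(q / (1 - ε))) ≤ 1 - q := by
  have h1 : 0 < 1 - q := by linarith
  have h2 : 0 < 1 - ε := by linarith
  rw [Real.exp_neg, inv_le_comm₀ (Real.exp_pos _) h1]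
  calc (1 - q)⁻¹ = q / (1 - q) + 1 := by field_simp; ring
    _ ≤ q / (1 - ε) + 1 := by gcongr
    _ ≤ Real.exp (q / (1 - ε)) := Real.add_one_le_exp _

/-- The probability that none of countably many independent events of small probability occurs,
in terms of the sum of their probabilities. -/
lemma measureReal_iInter_compl_bounds {ι : Type*} [Countable ι] {β : Type*} [MeasurableSpace β]
    {μ : Measure Ω} [IsProbabilityMeasure μ] {X : ι → Ω → β} (hX : ∀ i, Measurable (X i))
    (hind : iIndepFun X μ) {A : ι → Set β} (hA : ∀ i, MeasurableSet (A i)) {ε : ℝ} (hε0 : 0 ≤ ε) (hε : ε < 1)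
    (hle : ∀ i, μ (X i ⁻¹' A i) ≤ ENNReal.ofReal ε) (hsum : ∑' i, μ (X i ⁻¹' A i) < ∞) :
    Real.exp (-((∑' i, μ (X i ⁻¹' A i)).toReal / (1 - ε))) ≤ μ.real {ω | ∀ i, X i ω ∉ A i} ∧
      μ.real {ω | ∀ i, X i ω ∉ A i} ≤ Real.exp (-(∑' i, μ (X i ⁻¹' A i)).toReal) := by
  set q : ι → ℝ := fun i => μ.real (X i ⁻¹' A i) with hq
  have hqsum : HasSum q (∑' i, μ (X i ⁻¹' A i)).toReal := by
    rw [ENNReal.tsum_toReal_eq fun i => measure_ne_top _ _]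
    exact (ENNReal.summable_toReal hsum.ne).hasSum
  have hq0 : ∀ i, 0 ≤ q i := fun i => measureReal_nonneg
  have hq1 : ∀ i, q i ≤ 1 := fun i => measureReal_le_one
  have hqε : ∀ i, q i ≤ ε := fun i => ENNReal.toReal_le_of_le_ofReal hε0 (hle i)
  have hprod : ∀ s : Finset ι, μ.real (⋂ i ∈ s, X i ⁻¹' (A i)ᶜ) = ∏ i ∈ s, (1 - q i) := by
    intro s
    rw [measureReal_def, hind.measure_inter_preimage_eq_mul s fun i _ => (hA i).compl,
      ENNReal.toReal_prod]
    refine Finset.prod_congr rfl fun i _ => ?_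
    rw [preimage_compl, ← measureReal_def, probReal_compl_eq_one_sub (hX i (hA i))]
  have hset : {ω | ∀ i, X i ω ∉ A i} = ⋂ s : Finset ι, ⋂ i ∈ s, X i ⁻¹' (A i)ᶜ := by
    ext ω
    simp only [mem_ofPred_eq, mem_iInter, mem_preimage, mem_compl_iff]
    exact ⟨fun h s i _ => h i, fun h i => h {i} i (Finset.mem_singleton_self i)⟩
  have hlim : Tendsto (fun s : Finset ι => ∏ i ∈ s, (1 - q i)) atTop
      (𝓝 (μ.real {ω | ∀ i, X i ω ∉ A i})) := by
    simp_rw [← hprod, hset]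
    refine (ENNReal.tendsto_toReal (measure_ne_top _ _)).comp (tendsto_measure_iInter_atTop
      (fun s => (Finset.measurableSet_biInter s fun i _ => hX i (hA i).compl).nullMeasurableSet)
      (fun s t hst => biInter_subset_biInter_left hst) ⟨∅, measure_ne_top _ _⟩)
  have hS : Tendsto (fun s : Finset ι => ∑ i ∈ s, q i) atTop
      (𝓝 (∑' i, μ (X i ⁻¹' A i)).toReal) := hqsum
  constructor
  · refine le_of_tendsto_of_tendsto'
      ((Real.continuous_exp.tendsto _).comp (hS.div_const (1 - ε)).neg) hlim fun s => ?_
    simp only [Function.comp_apply, Finset.sum_div, ← Finset.sum_neg_distrib, Real.exp_sum]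
    exact Finset.prod_le_prod (fun i _ => (Real.exp_pos _).le) fun i _ =>
      exp_neg_div_le_one_sub (hq0 i) (hqε i) hε
  · refine le_of_tendsto_of_tendsto' hlim ((Real.continuous_exp.tendsto _).comp hS.neg) fun s => ?_
    simp only [Function.comp_apply, ← Finset.sum_neg_distrib, Real.exp_sum]
    exact Finset.prod_le_prod (fun i _ => sub_nonneg.2 (hq1 i)) fun i _ =>
      Real.one_sub_le_exp_neg _

/-- The signed distance to the origin of the line with normal direction `φ` through `y`. -/
def normalCoord (y : EuclideanSpace ℝ (Fin 2)) (φ : ℝ) : ℝ :=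
  y 0 * Real.cos φ + y 1 * Real.sin φ

/-- The marks `(φ, r)` for which the cylinder with axis `line p φ` and radius `r` contains `y`. -/
def hitMarks (y : EuclideanSpace ℝ (Fin 2)) (p : ℝ) : Set (ℝ × ℝ) :=
  {m | |normalCoord y m.1 - p| ≤ m.2}

lemma abs_normalCoord_le (y : EuclideanSpace ℝ (Fin 2)) (φ : ℝ) : |normalCoord y φ| ≤ ‖y‖ := by
  rw [EuclideanSpace.norm_eq, Fin.sum_univ_two]
  refine Real.abs_le_sqrt ?_
  simp only [Real.norm_eq_abs, sq_abs, normalCoord]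
  nlinarith [Real.sin_sq_add_cos_sq φ, sq_nonneg (y 0 * Real.sin φ - y 1 * Real.cos φ)]

lemma mem_line_add_closedBall {y : EuclideanSpace ℝ (Fin 2)} {p φ r : ℝ} :
    y ∈ line p φ + Metric.closedBall 0 r ↔ (φ, r) ∈ hitMarks y p := by
  simp only [hitMarks, mem_ofPred_eq, Set.mem_add, mem_closedBall_zero_iff]
  constructor
  · rintro ⟨u, hu, v, hv, rfl⟩
    refine le_trans (le_of_eq ?_) ((abs_normalCoord_le v φ).trans hv)
    have hu' : u 0 * Real.cos φ + u 1 * Real.sin φ = p := hu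
    congr 1
    simp only [normalCoord, PiLp.add_apply]
    linarith
  · intro h
    set d := normalCoord y φ - p with hd
    refine ⟨y - d • !₂[Real.cos φ, Real.sin φ], ?_, d • !₂[Real.cos φ, Real.sin φ], ?_, by simp⟩
    · simp only [line, mem_ofPred_eq, PiLp.sub_apply, PiLp.smul_apply, smul_eq_mul]
      simp only [normalCoord] at hd
      simp
      linear_combination (-d) * Real.sin_sq_add_cos_sq φ - hd
    · rw [norm_smul, EuclideanSpace.norm_eq, Fin.sum_univ_two]
      simpa using h

lemma measurableSet_hitMarks_prod :
    MeasurableSet {x : (EuclideanSpace ℝ (Fin 2) × ℝ) × (ℝ × ℝ) | x.2 ∈ hitMarks x.1.1 x.1.2} := by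
  have h : Measurable fun x : (EuclideanSpace ℝ (Fin 2) × ℝ) × (ℝ × ℝ) =>
      |normalCoord x.1.1 x.2.1 - x.1.2| := by
    unfold normalCoord
    fun_prop
  exact measurableSet_le h (by fun_prop)

lemma measurableSet_hitMarks (y : EuclideanSpace ℝ (Fin 2)) (p : ℝ) :
    MeasurableSet (hitMarks y p) :=
  (measurable_prodMk_left (x := (y, p))) measurableSet_hitMarks_prod

lemma measurable_measure_hitMarks (ρ : Measure (ℝ × ℝ)) [SFinite ρ]
    (y : EuclideanSpace ℝ (Fin 2)) : Measurable fun p => ρ (hitMarks y p) :=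
  (measurable_measure_prodMk_left measurableSet_hitMarks_prod).comp
    (measurable_prodMk_left (x := y))

lemma lintegral_measure_hitMarks (ρ : Measure (ℝ × ℝ)) [SFinite ρ]
    (y : EuclideanSpace ℝ (Fin 2)) :
    ∫⁻ p, ρ (hitMarks y p) = ∫⁻ m, ENNReal.ofReal (2 * m.2) ∂ρ := by
  have hs : MeasurableSet {x : ℝ × (ℝ × ℝ) | x.2 ∈ hitMarks y x.1} :=
    (by fun_prop : Measurable fun x : ℝ × (ℝ × ℝ) => ((y, x.1), x.2)) measurableSet_hitMarks_prod
  have h1 := Measure.prod_apply (μ := (volume : Measure ℝ)) (ν := ρ) hs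
  rw [Measure.prod_apply_symm hs] at h1
  refine h1.symm.trans (lintegral_congr fun m => ?_)
  have : (fun p => (p, m)) ⁻¹' {x : ℝ × (ℝ × ℝ) | x.2 ∈ hitMarks y x.1} =
      Icc (normalCoord y m.1 - m.2) (normalCoord y m.1 + m.2) := by
    ext p
    simp only [hitMarks, mem_preimage, mem_ofPred_eq, mem_Icc, abs_le]
    constructor <;> rintro ⟨h, h'⟩ <;> constructor <;> linarith
  rw [this, Real.volume_Icc]
  congr 1
  ring

lemma mem_cylinderSet_iff {Ω : Type*} {P Φ R : ℤ → Ω → ℝ} {ω : Ω} {y : EuclideanSpace ℝ (Fin 2)} :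
    y ∈ cylinderSet P Φ R ω ↔ ∃ i, (Φ i ω, R i ω) ∈ hitMarks y (P i ω) := by
  simp only [cylinderSet, mem_iUnion, mem_line_add_closedBall]

lemma measurableSet_cylinderSet_prod {P Φ R : ℤ → Ω → ℝ} (hP : ∀ i, Measurable (P i))
    (hΦ : ∀ i, Measurable (Φ i)) (hR : ∀ i, Measurable (R i)) :
    MeasurableSet {x : Ω × EuclideanSpace ℝ (Fin 2) | x.2 ∈ cylinderSet P Φ R x.1} := by
  simp only [mem_cylinderSet_iff, ofPred_exists]
  refine MeasurableSet.iUnion fun i => ?_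
  have h1 := hP i
  have h2 := hΦ i
  have h3 := hR i
  exact (by fun_prop : Measurable fun x : Ω × EuclideanSpace ℝ (Fin 2) =>
    ((x.2, P i x.1), (Φ i x.1, R i x.1))) measurableSet_hitMarks_prod

/-- The probability that `y` is not covered by the cylinder process, conditionally on the
points. -/
lemma measure_notMem_cylinderSet {μ : Measure Ω} [IsProbabilityMeasure μ] {P Φ R : ℤ → Ω → ℝ}
    {F G : Measure ℝ} (hP : ∀ i, Measurable (P i)) (hmarks : IsIndependentMarking μ P Φ R F G)
    (y : EuclideanSpace ℝ (Fin 2)) :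
    Measurable (fun ω => μ {ω' | ∀ i, (Φ i ω', R i ω') ∉ hitMarks y (P i ω)}) ∧
    μ {ω | y ∉ cylinderSet P Φ R ω} =
      ∫⁻ ω, μ {ω' | ∀ i, (Φ i ω', R i ω') ∉ hitMarks y (P i ω)} ∂μ := by
  have hX : Measurable fun ω i => P i ω := measurable_pi_lambda _ hP
  have hM : Measurable fun ω i => (Φ i ω, R i ω) :=
    measurable_pi_lambda _ fun i => (hmarks.measurable_angle i).prodMk (hmarks.measurable_radius i)
  have hD : MeasurableSet {x : (ℤ → ℝ) × (ℤ → ℝ × ℝ) | ∀ i, x.2 i ∉ hitMarks y (x.1 i)} := by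
    simp only [ofPred_forall]
    refine MeasurableSet.iInter fun i => MeasurableSet.compl ?_
    exact (by fun_prop : Measurable fun x : (ℤ → ℝ) × (ℤ → ℝ × ℝ) => ((y, x.1 i), x.2 i))
      measurableSet_hitMarks_prod
  have hprod := (indepFun_iff_map_prod_eq_prod_map_map hX.aemeasurable hM.aemeasurable).1
    hmarks.indep_points
  have hslice : ∀ x : ℤ → ℝ, μ.map (fun ω i => (Φ i ω, R i ω))
      (Prod.mk x ⁻¹' {x : (ℤ → ℝ) × (ℤ → ℝ × ℝ) | ∀ i, x.2 i ∉ hitMarks y (x.1 i)}) =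
      μ {ω' | ∀ i, (Φ i ω', R i ω') ∉ hitMarks y (x i)} := fun x =>
    Measure.map_apply hM (measurable_prodMk_left hD)
  have hmeas := measurable_measure_prodMk_left (ν := μ.map fun ω i => (Φ i ω, R i ω)) hD
  simp_rw [hslice] at hmeas
  refine ⟨hmeas.comp hX, ?_⟩
  have h1 := congrArg (fun m => m {x : (ℤ → ℝ) × (ℤ → ℝ × ℝ) | ∀ i, x.2 i ∉ hitMarks y (x.1 i)})
    hprod
  simp only [Measure.prod_apply hD, Measure.map_apply (hX.prodMk hM) hD] at h1
  simp_rw [hslice] at h1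
  rw [lintegral_map hmeas hX] at h1
  rw [← h1]
  congr 1
  ext ω
  simp [mem_cylinderSet_iff]

/-- Bounds for the probability that `y` is not covered by the cylinder process. -/
lemma measureReal_notMem_cylinderSet_bounds {μ : Measure Ω} [IsProbabilityMeasure μ]
    {P Φ R : ℤ → Ω → ℝ} {F G : Measure ℝ} [IsProbabilityMeasure F] [IsProbabilityMeasure G]
    (hP : ∀ i, Measurable (P i)) (hmarks : IsIndependentMarking μ P Φ R F G)
    (y : EuclideanSpace ℝ (Fin 2)) {ε m η : ℝ} (hε0 : 0 ≤ ε) (hε : ε < 1) (hm : 0 ≤ m)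
    (hle : ∀ p, G.prod F (hitMarks y p) ≤ ENNReal.ofReal ε)
    (hfin : ∀ᵐ ω ∂μ, ∑' i, G.prod F (hitMarks y (P i ω)) < ∞)
    (hint : Integrable (fun ω => (∑' i, G.prod F (hitMarks y (P i ω))).toReal) μ)
    (hη : ∫ ω, |(∑' i, G.prod F (hitMarks y (P i ω))).toReal - m| ∂μ ≤ η) :
    Real.exp (-(m / (1 - ε))) - η / (1 - ε) ≤ μ.real {ω | y ∉ cylinderSet P Φ R ω} ∧
      μ.real {ω | y ∉ cylinderSet P Φ R ω} ≤ Real.exp (-m) + η := by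
  set S : Ω → ℝ := fun ω => (∑' i, G.prod F (hitMarks y (P i ω))).toReal with hS
  set V : Ω → ℝ := fun ω => μ.real {ω' | ∀ i, (Φ i ω', R i ω') ∉ hitMarks y (P i ω)} with hV
  have h1ε : 0 < 1 - ε := by linarith
  obtain ⟨hmeas, hvoid⟩ := measure_notMem_cylinderSet hP hmarks y
  have hlaw : ∀ i p, μ ((fun ω => (Φ i ω, R i ω)) ⁻¹' hitMarks y p) =
      G.prod F (hitMarks y p) := fun i p => by
    rw [← (hmarks.law i).map_eq, Measure.map_apply
      ((hmarks.measurable_angle i).prodMk (hmarks.measurable_radius i))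
      (measurableSet_hitMarks y p)]
  have hbounds : ∀ᵐ ω ∂μ, Real.exp (-(S ω / (1 - ε))) ≤ V ω ∧ V ω ≤ Real.exp (-S ω) := by
    filter_upwards [hfin] with ω hω
    have := measureReal_iInter_compl_bounds
      (fun i => (hmarks.measurable_angle i).prodMk (hmarks.measurable_radius i))
      hmarks.marks_indep (A := fun i => hitMarks y (P i ω))
      (fun i => measurableSet_hitMarks y _) hε0 hε (fun i => (hlaw i _).trans_le (hle _))
      (by simpa only [hlaw] using hω)
    simpa only [hlaw] using this
  have hVint : Integrable V μ :=
    integrable_toReal_of_lintegral_ne_top hmeas.aemeasurable (hvoid ▸ measure_ne_top _ _)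
  have hVI : μ.real {ω | y ∉ cylinderSet P Φ R ω} = ∫ ω, V ω ∂μ := by
    rw [measureReal_def, hvoid]
    exact (integral_toReal hmeas.aemeasurable (.of_forall fun _ => measure_lt_top _ _)).symm
  have habs : Integrable (fun ω => |S ω - m|) μ := (hint.sub (integrable_const m)).abs
  have hS0 : ∀ ω, 0 ≤ S ω := fun ω => ENNReal.toReal_nonneg
  rw [hVI]
  constructor
  · have h : ∫ ω, (Real.exp (-(m / (1 - ε))) - |S ω - m| / (1 - ε)) ∂μ ≤ ∫ ω, V ω ∂μ := by
      refine integral_mono_ae ((integrable_const _).sub (habs.div_const _)) hVint ?_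
      filter_upwards [hbounds] with ω hω
      have h3 := exp_neg_le_exp_neg_add_abs (a := m / (1 - ε)) (b := S ω / (1 - ε))
        (div_nonneg hm h1ε.le)
      rw [← sub_div, abs_div, abs_of_pos h1ε, abs_sub_comm] at h3
      exact (sub_le_iff_le_add.2 h3).trans hω.1
    rw [integral_sub (integrable_const _) (habs.div_const _), integral_const, integral_div] at h
    simp only [probReal_univ, one_smul] at h
    refine le_trans ?_ h
    gcongr
  · have h : ∫ ω, V ω ∂μ ≤ ∫ ω, (Real.exp (-m) + |S ω - m|) ∂μ := by
      refine integral_mono_ae hVint ((integrable_const _).add habs) ?_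
      filter_upwards [hbounds] with ω hω
      exact hω.2.trans (exp_neg_le_exp_neg_add_abs (hS0 ω))
    rw [integral_add (integrable_const _) habs, integral_const] at h
    simp only [probReal_univ, one_smul] at h
    linarith

lemma finite_normalCoord_eq {x : EuclideanSpace ℝ (Fin 2)} (hx : x ≠ 0) (c : ℝ) :
    {φ ∈ Icc 0 Real.pi | normalCoord x φ = c}.Finite := by
  have hA : 0 < x 0 ^ 2 + x 1 ^ 2 := by
    by_contra! h
    refine hx ?_
    have h0 : x 0 = 0 := by nlinarith [sq_nonneg (x 0), sq_nonneg (x 1)]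
    have h1 : x 1 = 0 := by nlinarith [sq_nonneg (x 0), sq_nonneg (x 1)]
    ext i
    fin_cases i
    · exact h0
    · exact h1
  set A := x 0 ^ 2 + x 1 ^ 2 with hAdef
  set D := (c * x 0) ^ 2 - A * (c ^ 2 - x 1 ^ 2) with hD
  refine Set.Finite.of_finite_image (f := Real.cos) ?_
    (Real.injOn_cos.mono fun φ hφ => hφ.1)
  refine (toFinite {(c * x 0 + √D) / A, (c * x 0 - √D) / A}).subset ?_
  rintro _ ⟨φ, ⟨-, hφ⟩, rfl⟩
  have hsq : (A * Real.cos φ - c * x 0) ^ 2 = D := by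
    have h1 : x 1 * Real.sin φ = c - x 0 * Real.cos φ := by
      rw [← hφ, normalCoord]; ring
    have h2 : x 1 ^ 2 * (1 - Real.cos φ ^ 2) = (c - x 0 * Real.cos φ) ^ 2 := by
      rw [← h1, ← Real.sin_sq]; ring
    rw [hD, hAdef]
    linear_combination (-(x 0 ^ 2 + x 1 ^ 2)) * h2
  have hD0 : 0 ≤ D := hsq ▸ sq_nonneg _
  rw [← Real.sq_sqrt hD0, sq_eq_sq_iff_eq_or_eq_neg] at hsq
  rcases hsq with h | h
  · left
    rw [eq_div_iff hA.ne']
    linarith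
  · right
    rw [mem_singleton_iff, eq_div_iff hA.ne']
    linarith

lemma nullSingletonClass_of_continuous_cdf {G : Measure ℝ} [IsProbabilityMeasure G]
    (hG : Continuous (cdf G)) : NullSingletonClass G := by
  refine ⟨fun a => ?_⟩
  rw [← measure_cdf G, StieltjesFunction.measure_singleton,
    hG.continuousAt.continuousWithinAt.leftLim_eq, sub_self, ENNReal.ofReal_zero]

lemma IsIndependentMarking.measure_compl_Icc {μ : Measure Ω} {P Φ R : ℤ → Ω → ℝ}
    {F G : Measure ℝ} [IsProbabilityMeasure F] (hmarks : IsIndependentMarking μ P Φ R F G) :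
    G (Icc 0 Real.pi)ᶜ = 0 := by
  have hs : MeasurableSet ((Icc 0 Real.pi)ᶜ ×ˢ (univ : Set ℝ)) :=
    measurableSet_Icc.compl.prod MeasurableSet.univ
  have h : G.prod F ((Icc 0 Real.pi)ᶜ ×ˢ univ) = 0 := by
    rw [← (hmarks.law 0).map_eq, Measure.map_apply
      ((hmarks.measurable_angle 0).prodMk (hmarks.measurable_radius 0)) hs]
    convert measure_empty (μ := μ)
    ext ω
    simp [(hmarks.angle_mem 0 ω).1, (hmarks.angle_mem 0 ω).2]
  rwa [Measure.prod_prod, measure_univ, mul_one] at h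

lemma IsIndependentMarking.measure_normalCoord_eq {μ : Measure Ω} {P Φ R : ℤ → Ω → ℝ}
    {F G : Measure ℝ} [IsProbabilityMeasure F] [IsProbabilityMeasure G]
    (hmarks : IsIndependentMarking μ P Φ R F G) (hG : Continuous (cdf G))
    {x : EuclideanSpace ℝ (Fin 2)} (hx : x ≠ 0) (c : ℝ) :
    G {φ | normalCoord x φ = c} = 0 := by
  have := nullSingletonClass_of_continuous_cdf hG
  refine measure_mono_null (t := (Icc 0 Real.pi)ᶜ ∪ {φ ∈ Icc 0 Real.pi | normalCoord x φ = c})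
    (fun φ hφ => ?_)
    (measure_union_null hmarks.measure_compl_Icc ((finite_normalCoord_eq hx c).measure_zero G))
  by_cases h : φ ∈ Icc 0 Real.pi
  · exact Or.inr ⟨h, hφ⟩
  · exact Or.inl h

/-- The pairs of marks for which the two cylinders can both contain `y`. -/
def jointHitMarks (y : EuclideanSpace ℝ (Fin 2)) : Set ((ℝ × ℝ) × (ℝ × ℝ)) :=
  {z | |normalCoord y z.1.1 - normalCoord y z.2.1| ≤ z.1.2 + z.2.2}

lemma measurableSet_jointHitMarks (y : EuclideanSpace ℝ (Fin 2)) :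
    MeasurableSet (jointHitMarks y) := by
  have h : Measurable fun z : (ℝ × ℝ) × (ℝ × ℝ) =>
      |normalCoord y z.1.1 - normalCoord y z.2.1| := by
    unfold normalCoord
    fun_prop
  exact measurableSet_le h (by fun_prop)

lemma measure_hitMarks_sq_le (ρ : Measure (ℝ × ℝ)) [SFinite ρ]
    (y : EuclideanSpace ℝ (Fin 2)) (p : ℝ) :
    ρ (hitMarks y p) ^ 2 ≤ ρ.prod ρ (jointHitMarks y) := by
  rw [sq, ← Measure.prod_prod]
  refine measure_mono fun z hz => ?_
  have h1 : |normalCoord y z.1.1 - p| ≤ z.1.2 := hz.1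
  have h2 : |normalCoord y z.2.1 - p| ≤ z.2.2 := hz.2
  rw [abs_sub_comm] at h2
  exact (abs_sub_le _ p _).trans (add_le_add h1 h2)

lemma normalCoord_smul (t : ℝ) (x : EuclideanSpace ℝ (Fin 2)) (φ : ℝ) :
    normalCoord (t • x) φ = t * normalCoord x φ := by
  simp only [normalCoord, PiLp.smul_apply, smul_eq_mul]
  ring

lemma IsIndependentMarking.tendsto_measure_jointHitMarks {μ : Measure Ω} {P Φ R : ℤ → Ω → ℝ}
    {F G : Measure ℝ} [IsProbabilityMeasure F] [IsProbabilityMeasure G]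
    (hmarks : IsIndependentMarking μ P Φ R F G) (hG : Continuous (cdf G))
    {x : EuclideanSpace ℝ (Fin 2)} (hx : x ≠ 0) :
    Tendsto (fun t : ℝ => (G.prod F).prod (G.prod F) (jointHitMarks (t • x))) atTop (𝓝 0) := by
  have hdiag : ∀ᵐ z ∂(G.prod F).prod (G.prod F),
      normalCoord x z.1.1 ≠ normalCoord x z.2.1 := by
    have hs : MeasurableSet {z : (ℝ × ℝ) × (ℝ × ℝ) | normalCoord x z.1.1 = normalCoord x z.2.1} :=
      measurableSet_eq_fun (by unfold normalCoord; fun_prop) (by unfold normalCoord; fun_prop)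
    rw [ae_iff]
    simp only [not_not]
    rw [Measure.measure_prod_null hs]
    refine .of_forall fun m => ?_
    have : Prod.mk m ⁻¹' {z : (ℝ × ℝ) × (ℝ × ℝ) | normalCoord x z.1.1 = normalCoord x z.2.1} =
        {φ | normalCoord x φ = normalCoord x m.1} ×ˢ univ := by
      ext m'
      simp [eq_comm]
    simp only [this, Measure.prod_prod, hmarks.measure_normalCoord_eq hG hx, zero_mul,
      Pi.zero_apply]
  have h := tendsto_measure_of_ae_tendsto_indicator_of_isFiniteMeasure (atTop : Filter ℝ)
    (μ := (G.prod F).prod (G.prod F)) (As := fun t => jointHitMarks (t • x)) MeasurableSet.empty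
    (fun t => measurableSet_jointHitMarks _) ?_
  · simpa using h
  filter_upwards [hdiag] with z hz
  have hd : 0 < |normalCoord x z.1.1 - normalCoord x z.2.1| := abs_pos.2 (sub_ne_zero.2 hz)
  filter_upwards [eventually_gt_atTop 0,
    eventually_gt_atTop ((z.1.2 + z.2.2) / |normalCoord x z.1.1 - normalCoord x z.2.1|)]
    with t ht0 ht
  simp only [jointHitMarks, mem_ofPred_eq, normalCoord_smul, mem_empty_iff_false, iff_false,
    not_le, ← mul_sub, abs_mul, abs_of_pos ht0]
  exact (div_lt_iff₀ hd).1 ht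

lemma IsIndependentMarking.meanBase_eq {μ : Measure Ω} {P Φ R : ℤ → Ω → ℝ} {F G : Measure ℝ}
    (hmarks : IsIndependentMarking μ P Φ R F G) : meanBase μ R = ∫ ω, 2 * R 0 ω ∂μ := by
  refine integral_congr_ae (.of_forall fun ω => ?_)
  have := hmarks.radius_nonneg 0 ω
  simp only
  rw [Real.volume_real_Icc_of_le (by linarith)]
  ring

lemma IsIndependentMarking.lintegral_measure_hitMarks_eq {μ : Measure Ω} {P Φ R : ℤ → Ω → ℝ}
    {F G : Measure ℝ} [IsProbabilityMeasure F] [IsProbabilityMeasure G]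
    (hmarks : IsIndependentMarking μ P Φ R F G) (hR : Integrable (R 0) μ)
    (y : EuclideanSpace ℝ (Fin 2)) :
    ∫⁻ p, G.prod F (hitMarks y p) = ENNReal.ofReal (meanBase μ R) := by
  rw [lintegral_measure_hitMarks, hmarks.meanBase_eq, ofReal_integral_eq_lintegral_ofReal
    (hR.const_mul 2) (.of_forall fun ω => mul_nonneg zero_le_two (hmarks.radius_nonneg 0 ω)),
    ← (hmarks.law 0).map_eq, lintegral_map (by fun_prop)
      ((hmarks.measurable_angle 0).prodMk (hmarks.measurable_radius 0))]

lemma IsBrillingerMixing.tendsto_measureReal_notMem_cylinderSet {μ : Measure Ω}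
    [IsProbabilityMeasure μ] {P Φ R : ℤ → Ω → ℝ} {F G : Measure ℝ} [IsProbabilityMeasure F]
    [IsProbabilityMeasure G] (hP : IsBrillingerMixing μ P)
    (hmarks : IsIndependentMarking μ P Φ R F G) (hR : Integrable (R 0) μ)
    (hG : Continuous (cdf G)) {x : EuclideanSpace ℝ (Fin 2)} (hx : x ≠ 0) :
    Tendsto (fun t : ℝ => μ.real {ω | t • x ∉ cylinderSet P Φ R ω}) atTop
      (𝓝 (Real.exp (-(intensity μ P * meanBase μ R)))) := by
  obtain ⟨C, hC⟩ := hP.exists_integral_abs_sub_le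
  set a := meanBase μ R with ha
  set m := intensity μ P * a with hm
  have ha0 : 0 ≤ a := by
    rw [ha, hmarks.meanBase_eq]
    exact integral_nonneg fun ω => mul_nonneg zero_le_two (hmarks.radius_nonneg 0 ω)
  have hm0 : 0 ≤ m := mul_nonneg hP.intensity_pos.le ha0
  set ε : ℝ → ℝ := fun t => √(((G.prod F).prod (G.prod F)).real (jointHitMarks (t • x))) with hεdef
  have hε : Tendsto ε atTop (𝓝 0) := by
    have h := (ENNReal.tendsto_toReal ENNReal.zero_ne_top).comp
      (hmarks.tendsto_measure_jointHitMarks hG hx)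
    simpa [hεdef, measureReal_def] using h.sqrt
  have hη : Tendsto (fun t => √(C * ε t * a)) atTop (𝓝 0) := by
    simpa using ((hε.const_mul C).mul_const a).sqrt
  have h1ε : Tendsto (fun t => 1 - ε t) atTop (𝓝 1) := by simpa using hε.const_sub 1
  have hbounds : ∀ᶠ t in atTop,
      Real.exp (-(m / (1 - ε t))) - √(C * ε t * a) / (1 - ε t) ≤
        μ.real {ω | t • x ∉ cylinderSet P Φ R ω} ∧
      μ.real {ω | t • x ∉ cylinderSet P Φ R ω} ≤ Real.exp (-m) + √(C * ε t * a) := by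
    filter_upwards [hε.eventually_lt_const one_pos] with t ht
    have hle : ∀ p, G.prod F (hitMarks (t • x) p) ≤ ENNReal.ofReal (ε t) := by
      intro p
      rw [← ENNReal.ofReal_toReal (measure_ne_top (G.prod F) _)]
      refine ENNReal.ofReal_le_ofReal (Real.le_sqrt_of_sq_le ?_)
      rw [← ENNReal.toReal_pow]
      exact ENNReal.toReal_mono (measure_ne_top _ _) (measure_hitMarks_sq_le _ _ _)
    obtain ⟨h1, h2, h3⟩ := hC _ (ε t) a (Real.sqrt_nonneg _) ha0
      (measurable_measure_hitMarks (G.prod F) (t • x)) hle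
      (hmarks.lintegral_measure_hitMarks_eq hR _)
    exact measureReal_notMem_cylinderSet_bounds hP.measurable hmarks (t • x) (Real.sqrt_nonneg _)
      ht hm0 hle h1 h2 h3
  refine tendsto_of_tendsto_of_tendsto_of_le_of_le' ?_ ?_ (hbounds.mono fun _ h => h.1)
    (hbounds.mono fun _ h => h.2)
  · have h1 : Tendsto (fun t => Real.exp (-(m / (1 - ε t)))) atTop (𝓝 (Real.exp (-(m / 1)))) :=
      (Real.continuous_exp.tendsto _).comp (tendsto_const_nhds.div h1ε one_ne_zero).neg
    simpa using h1.sub (hη.div h1ε one_ne_zero)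
  · simpa using hη.const_add (Real.exp (-m))

lemma integral_measureReal_cylinderSet_inter {μ : Measure Ω} [IsProbabilityMeasure μ]
    {P Φ R : ℤ → Ω → ℝ} (hP : ∀ i, Measurable (P i)) (hΦ : ∀ i, Measurable (Φ i))
    (hR : ∀ i, Measurable (R i)) {A : Set (EuclideanSpace ℝ (Fin 2))}
    (hfin : volume A ≠ ∞) :
    Integrable (fun ω => volume.real (cylinderSet P Φ R ω ∩ A)) μ ∧
      ∫ ω, volume.real (cylinderSet P Φ R ω ∩ A) ∂μ =
        ∫ y in A, (1 - μ.real {ω | y ∉ cylinderSet P Φ R ω}) := by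
  have hs := measurableSet_cylinderSet_prod hP hΦ hR
  set s := {x : Ω × EuclideanSpace ℝ (Fin 2) | x.2 ∈ cylinderSet P Φ R x.1} with hsdef
  have hω : ∀ ω, (volume.restrict A) (Prod.mk ω ⁻¹' s) = volume (cylinderSet P Φ R ω ∩ A) :=
    fun ω => Measure.restrict_apply (measurable_prodMk_left hs)
  have hmeas : Measurable fun ω => volume (cylinderSet P Φ R ω ∩ A) := by
    simpa only [hω] using measurable_measure_prodMk_left (ν := volume.restrict A) hs
  have hle : ∀ ω, volume (cylinderSet P Φ R ω ∩ A) ≤ volume A := fun ω =>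
    measure_mono inter_subset_right
  have hlint : ∫⁻ ω, volume (cylinderSet P Φ R ω ∩ A) ∂μ ≠ ∞ := by
    refine ne_top_of_le_ne_top hfin ((lintegral_mono hle).trans ?_)
    simp
  refine ⟨integrable_toReal_of_lintegral_ne_top hmeas.aemeasurable hlint, ?_⟩
  have hfub : ∫⁻ ω, volume (cylinderSet P Φ R ω ∩ A) ∂μ =
      ∫⁻ y in A, μ {ω | y ∈ cylinderSet P Φ R ω} := by
    have h1 := Measure.prod_apply (μ := μ) (ν := volume.restrict A) hs
    rw [Measure.prod_apply_symm hs] at h1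
    simp only [hω] at h1
    exact h1.symm
  have hcompl : ∀ y, 1 - μ.real {ω | y ∉ cylinderSet P Φ R ω} =
      (μ {ω | y ∈ cylinderSet P Φ R ω}).toReal := by
    intro y
    have hy : MeasurableSet {ω | y ∈ cylinderSet P Φ R ω} := measurable_prodMk_right hs
    have := probReal_compl_eq_one_sub (μ := μ) hy
    rw [show {ω | y ∉ cylinderSet P Φ R ω} = {ω | y ∈ cylinderSet P Φ R ω}ᶜ from rfl, this,
      sub_sub_cancel]
    rfl
  simp_rw [hcompl]
  have hmeas' : Measurable fun y => μ {ω | y ∈ cylinderSet P Φ R ω} :=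
    measurable_measure_prodMk_right hs
  rw [integral_toReal hmeas'.aemeasurable (.of_forall fun _ => measure_lt_top _ _), ← hfub]
  exact integral_toReal hmeas.aemeasurable (.of_forall fun ω => (hle ω).trans_lt hfin.lt_top)

lemma measurable_measureReal_notMem_cylinderSet (μ : Measure Ω) [IsProbabilityMeasure μ]
    {P Φ R : ℤ → Ω → ℝ} (hP : ∀ i, Measurable (P i)) (hΦ : ∀ i, Measurable (Φ i))
    (hR : ∀ i, Measurable (R i)) :
    Measurable fun y => μ.real {ω | y ∉ cylinderSet P Φ R ω} :=
  (measurable_measure_prodMk_right (measurableSet_cylinderSet_prod hP hΦ hR).compl).ennreal_toReal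

lemma hasSum_one_sub_exp_neg (m : ℝ) :
    HasSum (fun k : ℕ => (-1 : ℝ) ^ k / ((k + 1).factorial : ℝ) * m ^ (k + 1))
      (1 - Real.exp (-m)) := by
  have h : HasSum (fun n : ℕ => (-m) ^ n / (n.factorial : ℝ)) (Real.exp (-m)) := by
    rw [Real.exp_eq_exp_ℝ]
    exact NormedSpace.expSeries_div_hasSum_exp (-m)
  have h1 := ((hasSum_nat_add_iff' 1).2 h).neg
  simp only [Finset.range_one, Finset.sum_singleton, pow_zero, Nat.factorial_zero, Nat.cast_one,
    div_one, neg_sub] at h1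
  have heq : (fun k : ℕ => (-1 : ℝ) ^ k / ((k + 1).factorial : ℝ) * m ^ (k + 1)) =
      fun k => -((-m) ^ (k + 1) / ((k + 1).factorial : ℝ)) := by
    funext k
    rw [neg_pow m, pow_succ (-1 : ℝ)]
    ring
  rwa [heq]

end CylinderProcess

end

theorem corollary2 {Ω : Type*} [MeasurableSpace Ω] (μ : Measure Ω) [IsProbabilityMeasure μ]
    (P Φ R : ℤ → Ω → ℝ) (F G : Measure ℝ) [IsProbabilityMeasure F] [IsProbabilityMeasure G]
    (hP : CylinderProcess.IsBrillingerMixing μ P)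
    (hmarks : CylinderProcess.IsIndependentMarking μ P Φ R F G)
    (hR : Integrable (R 0) μ)
    (hG : Continuous (cdf G))
    (K : Set (EuclideanSpace ℝ (Fin 2)))
    (hK : IsCompact K) (hstar : StarConvex ℝ 0 K) (h0 : 0 ∈ interior K) :
    (∀ ϱ : ℝ, Integrable
      (fun ω => volume.real (CylinderProcess.cylinderSet P Φ R ω ∩ ϱ • K)) μ) ∧
    Tendsto
      (fun ϱ : ℝ =>
        (∫ ω, volume.real (CylinderProcess.cylinderSet P Φ R ω ∩ ϱ • K) ∂μ) /
          volume.real (ϱ • K))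
      atTop
      (𝓝 (1 - Real.exp
        (-(CylinderProcess.intensity μ P * CylinderProcess.meanBase μ R)))) ∧
    HasSum
      (fun k : ℕ => (-1 : ℝ) ^ k / ((k + 1).factorial : ℝ) *
        (CylinderProcess.intensity μ P * CylinderProcess.meanBase μ R) ^ (k + 1))
      (1 - Real.exp
        (-(CylinderProcess.intensity μ P * CylinderProcess.meanBase μ R))) := by
  have hPm := hP.measurable
  have hΦm := hmarks.measurable_angle
  have hRm := hmarks.measurable_radius
  have hKfin : ∀ ϱ : ℝ, volume (ϱ • K) ≠ ⊤ := fun ϱ => (hK.smul ϱ).measure_lt_top.ne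
  have hint := fun ϱ => CylinderProcess.integral_measureReal_cylinderSet_inter (μ := μ)
    hPm hΦm hRm (hKfin ϱ)
  refine ⟨fun ϱ => (hint ϱ).1, ?_, CylinderProcess.hasSum_one_sub_exp_neg _⟩
  set m := CylinderProcess.intensity μ P * CylinderProcess.meanBase μ R with hm
  set g : EuclideanSpace ℝ (Fin 2) → ℝ :=
    fun y => 1 - μ.real {ω | y ∉ CylinderProcess.cylinderSet P Φ R ω} with hg
  have hgm : Measurable g :=
    measurable_const.sub (CylinderProcess.measurable_measureReal_notMem_cylinderSet μ hPm hΦm hRm)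
  have hvol : 0 < volume.real K :=
    ENNReal.toReal_pos ((isOpen_interior.measure_pos volume ⟨0, h0⟩).trans_le
      (measure_mono interior_subset)).ne' hK.measure_lt_top.ne
  have hratio : ∀ ϱ : ℝ, 0 < ϱ →
      (∫ x in K, g (ϱ • x)) / volume.real K =
        (∫ ω, volume.real (CylinderProcess.cylinderSet P Φ R ω ∩ ϱ • K) ∂μ) /
          volume.real (ϱ • K) := by
    intro ϱ hϱ
    rw [(hint ϱ).2, Measure.setIntegral_comp_smul_of_pos volume g K hϱ]
    simp only [measureReal_def, Measure.addHaar_smul, ENNReal.toReal_mul,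
      abs_of_pos (pow_pos hϱ _), ENNReal.toReal_ofReal (pow_pos hϱ _).le, smul_eq_mul]
    rw [inv_mul_eq_div, div_div]
  have hlim : Tendsto (fun ϱ : ℝ => ∫ x in K, g (ϱ • x)) atTop
      (𝓝 (∫ _ in K, (1 - Real.exp (-m)))) := by
    have : IsFiniteMeasure (volume.restrict K) := ⟨by simpa using hK.measure_lt_top⟩
    refine tendsto_integral_filter_of_dominated_convergence (fun _ => 1)
      (.of_forall fun ϱ => (hgm.comp (measurable_const_smul ϱ)).aestronglyMeasurable)
      (.of_forall fun ϱ => .of_forall fun x => ?_) (integrable_const 1) ?_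
    · rw [Real.norm_eq_abs, abs_le]
      have h1 := measureReal_nonneg (μ := μ)
        (s := {ω | ϱ • x ∉ CylinderProcess.cylinderSet P Φ R ω})
      have h2 := measureReal_le_one (μ := μ)
        (s := {ω | ϱ • x ∉ CylinderProcess.cylinderSet P Φ R ω})
      constructor <;> simp only [hg] <;> linarith
    · filter_upwards [ae_restrict_of_ae (Measure.ae_ne volume 0)] with x hx
      exact (hP.tendsto_measureReal_notMem_cylinderSet hmarks hR hG hx).const_sub 1
  have hfinal := hlim.div_const (volume.real K)
  rw [setIntegral_const, smul_eq_mul, mul_div_cancel_left₀ _ hvol.ne'] at hfinal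
  refine hfinal.congr' ?_
  filter_upwards [eventually_gt_atTop 0] with ϱ hϱ
  exact hratio ϱ hϱ
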